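/- Let $\mathbb N=\{0,1,2,\dots\}$ and $\mathbb N^+=\mathbb N\setminus\{0\}$. For a set $\Gamma$ let $\Gamma^+$ be the set of non-empty finite words over $\Gamma$. A sequence over $\Gamma$ is a map $\mathbb N\to\Gamma$. A sequence $\sigma$ over an alphabet $\Sigma$ is *morphic* if there are a finite alphabet $\Gamma$, a map $f:\Gamma\to\Gamma^+$ (extended to words by concatenation), a letter $a\in\Gamma$ with $f(a)=au$ for some $u\in\Gamma^+$, and a map $\tau:\Gamma\to\Sigma$, such that $\sigma(i)=\tau(f^\infty(a)(i))$ for all $i\in\mathbb N$; here $f^\infty(a)$ is the limit of the words $f^n(a)$, each of which is a prefix of the next. A *tree function* is a weakly monotone and surjective function $P:\mathbb N^+\to\mathbb N$. It defines an infinite ordered tree on $\mathbb N$ with root $0$, in which $P(j)$ is the parent of $j$ for every $j>0$ and the (finitely many, at least one) children of a node are ordered increasingly. The tree function $P$ is *rational* if this tree has only finitely many distinct subtrees, where the subtree with root $n$ is the ordered tree formed by $n$ and its descendants, and two subtrees are equal if they are equal as ordered trees when the numbering of the nodes is ignored. For $n\in\mathbb N$ let $$S_P(n)=\{m\in\mathbb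 N \mid \exists k\in\mathbb N:\ P^k(m)=n\},$$ where $P^0(m)=m$ and $P^{k+1}(m)=P(P^k(m))$ if $P^k(m)$ is defined and positive, and is undefined otherwise; so $S_P(n)$ is the (infinite) set of descendants of $n$, including $n$. For an infinite set $S=\{s_0<s_1<s_2<\cdots\}\subseteq\mathbb N$ let $\sigma^S$ be the sequence with $\sigma^S(i)=\sigma(s_i)$ for all $i\in\mathbb N$. **Theorem.** A sequence $\sigma$ over an alphabet $\Sigma$ is morphic if and only if there exists a rational tree function $P:\mathbb N^+\to\mathbb N$ such that the set of sequences $$\{\sigma^{S_P(n)} \mid n\in\mathbb N\}$$ is finite. -/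

import Mathlib

open Filter

namespace MorphicSeq

/-- The morphism `f : Γ → Γ*` applied to a word: the concatenation of the images of its letters. -/
def applyWord {Γ : Type*} (f : Γ → List Γ) (w : List Γ) : List Γ := w.flatMap f

/-- The sequence `ρ` is the limit of the words `w 0, w 1, w 2, …`: for every position `i`,
all but finitely many of the words have a letter at position `i`, and this letter is `ρ i`. -/
def IsLimitOfWords {Γ : Type*} (w : ℕ → List Γ) (ρ : ℕ → Γ) : Prop :=
  ∀ i : ℕ, ∀ᶠ n in atTop, (w n)[i]? = some (ρ i)

/-- `ρ = f^∞(a)` is the limit of `f^n(a)`, for `f : Γ → Γ⁺` with `f(a) = a u`, `u ∈ Γ⁺`. -/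
def IsPureMorphic {Γ : Type*} (ρ : ℕ → Γ) : Prop :=
  ∃ (f : Γ → List Γ) (a : Γ) (u : List Γ),
    (∀ b, f b ≠ []) ∧ u ≠ [] ∧ f a = a :: u ∧
      IsLimitOfWords (fun n => (applyWord f)^[n] [a]) ρ

/-- A morphic sequence: `σ = τ(ρ)` for a coding `τ : Γ → A` and a pure morphic sequence `ρ`
over a finite alphabet `Γ`. -/
def IsMorphic {A : Type*} (σ : ℕ → A) : Prop :=
  ∃ (Γ : Type) (_ : Finite Γ) (τ : Γ → A) (ρ : ℕ → Γ), IsPureMorphic ρ ∧ ∀ i, σ i = τ (ρ i)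

/-- Tree functions: weakly monotone and surjective functions `P : ℕ⁺ → ℕ`. Such a function defines
an ordered tree on `ℕ` with root `0` in which `P j` is the parent of `j`. -/
def IsTreeFunction (P : ℕ+ → ℕ) : Prop := Monotone P ∧ Function.Surjective P

/-- The set of children of the node `n`. -/
def children (P : ℕ+ → ℕ) (n : ℕ) : Set ℕ := {m | ∃ h : 0 < m, P ⟨m, h⟩ = n}

/-- The number of children of the node `n` (finite and positive for a tree function). -/
noncomputable def arity (P : ℕ+ → ℕ) (n : ℕ) : ℕ := (children P n).ncard

/-- The `i`-th child of `n`, for `i < arity P n`, the children being listed in increasing order. -/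
noncomputable def child (P : ℕ+ → ℕ) (n i : ℕ) : ℕ := Nat.nth (fun m => m ∈ children P n) i

/-- The node reached from `n` along the position `w ∈ ℕ*`, where the letter `i` means
"go to the `i`-th child"; it is `none` if `w` is not a position of the subtree with root `n`. -/
noncomputable def nodeAt (P : ℕ+ → ℕ) : ℕ → List ℕ → Option ℕ
  | n, [] => some n
  | n, i :: w => if i < arity P n then nodeAt P (child P n i) w else none

/-- The subtree with root `n`, as an infinite term `ℕ* → ℕ ∪ {⊥}` in which the symbol at a position
is the number of children of the node there. The numbering of the nodes is forgotten, so that two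
nodes have the same subtree iff the ordered trees hanging below them have the same shape. -/
noncomputable def subtree (P : ℕ+ → ℕ) (n : ℕ) : List ℕ → Option ℕ :=
  fun w => (nodeAt P n w).map (arity P)

/-- Rational tree functions: the tree contains only finitely many distinct subtrees. -/
def IsRationalTreeFunction (P : ℕ+ → ℕ) : Prop :=
  IsTreeFunction P ∧ (Set.range (subtree P)).Finite

/-- The partial iterates of `P`: `P^0(m) = m`, and `P^(k+1)(m) = P(P^k(m))`, which is undefined
(`none`) unless `P^k(m)` is defined and positive. -/
def iter (P : ℕ+ → ℕ) : ℕ → ℕ → Option ℕ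
  | 0, m => some m
  | k + 1, m => (iter P k m).bind fun j => if h : 0 < j then some (P ⟨j, h⟩) else none

/-- `S_P(n) = {m | ∃ k, P^k(m) = n}`, the set of descendants of `n`, including `n` itself. -/
def descendants (P : ℕ+ → ℕ) (n : ℕ) : Set ℕ := {m | ∃ k, iter P k m = some n}

/-- The subsequence `σ^S` for an infinite set `S = {s₀ < s₁ < s₂ < ⋯}`: `σ^S(i) = σ(sᵢ)`. -/
noncomputable def subseq {A : Type*} (σ : ℕ → A) (S : Set ℕ) : ℕ → A :=
  fun i => σ (Nat.nth (fun m => m ∈ S) i)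

end MorphicSeq

namespace MorphicSeq

/-! A tree function numbers its tree breadth-first: the children of `i` are the interval from `b i`
to `b (i + 1) - 1`. The descendants of `n`, listed increasingly, are again numbered breadth-first,
so the index of a child among them depends only on earlier arities (`child_nthDescendant`). Hence a
bisimulation relating `n` and `m` also relates their `j`-th descendants (`rel_nthDescendant`).

From a morphic `σ = τ(ρ)` with `ρ` fixed by `f`, let the children of `i` be the positions that `f (ρ
i)` occupies in `ρ`. A non-root node's letter then determines both its subtree and the letters along
its descendants, so finitely many of each occur.

Conversely, colour each node by its subtree and its subsequence. The colour determines the colours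
of the children (`isBisimulation_subtree_subseq`), so the colours in numerical order form the fixed
point of a morphism on a finite alphabet, and a colour reveals `σ n` as the first term of its
subsequence. -/

/-- `b i` is the least child of the node `i`, for every `i`. -/
structure IsFirstChild (P : ℕ+ → ℕ) (b : ℕ → ℕ) : Prop where
  zero : b 0 = 1
  strictMono : StrictMono b
  le_iff : ∀ (j : ℕ) (h : 0 < j) (i : ℕ), i ≤ P ⟨j, h⟩ ↔ b i ≤ j

/-- Monotonicity makes the least preimage a lower adjoint of `P`, which is `le_iff`; surjectivity
makes it defined everywhere. -/
theorem IsTreeFunction.exists_isFirstChild {P : ℕ+ → ℕ} (hP : IsTreeFunction P) :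
    ∃ b, IsFirstChild P b := by
  classical
  obtain ⟨hm, hs⟩ := hP
  have hex : ∀ i, ∃ j, ∃ h : 0 < j, P ⟨j, h⟩ = i := fun i => by
    obtain ⟨⟨j, h⟩, hj⟩ := hs i
    exact ⟨j, h, hj⟩
  have hle : ∀ (j : ℕ) (h : 0 < j) (i : ℕ), i ≤ P ⟨j, h⟩ ↔ Nat.find (hex i) ≤ j := by
    intro j h i
    obtain ⟨h0, h1⟩ := Nat.find_spec (hex i)
    constructor
    · intro hi
      by_contra! hlt
      have h2 : P ⟨j, h⟩ ≤ P ⟨Nat.find (hex i), h0⟩ := hm (Subtype.mk_le_mk.2 hlt.le)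
      exact Nat.find_min (hex i) hlt ⟨h, by omega⟩
    · intro hi
      have h2 : P ⟨Nat.find (hex i), h0⟩ ≤ P ⟨j, h⟩ := hm (Subtype.mk_le_mk.2 hi)
      omega
  refine ⟨fun i => Nat.find (hex i), ?_, strictMono_nat_of_lt_succ fun i => ?_, hle⟩
  · have h1 := (hle 1 one_pos 0).1 (Nat.zero_le _)
    obtain ⟨h0, -⟩ := Nat.find_spec (hex 0)
    exact le_antisymm h1 h0
  · obtain ⟨h0, h1⟩ := Nat.find_spec (hex i)
    by_contra! hlt
    have := (hle _ h0 (i + 1)).2 hlt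
    omega

namespace IsFirstChild

variable {P : ℕ+ → ℕ} {b : ℕ → ℕ}

theorem pos (hb : IsFirstChild P b) (i : ℕ) : 0 < b i := by
  have := hb.strictMono.monotone (Nat.zero_le i)
  have := hb.zero
  omega

theorem lt (hb : IsFirstChild P b) (i : ℕ) : i < b i := by
  induction i with
  | zero => exact hb.pos 0
  | succ i ih => have := hb.strictMono (Nat.lt_add_one i); omega

theorem parent_eq_iff (hb : IsFirstChild P b) {j i : ℕ} (h : 0 < j) :
    P ⟨j, h⟩ = i ↔ b i ≤ j ∧ j < b (i + 1) := by
  have h1 := hb.le_iff j h i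
  have h2 := hb.le_iff j h (i + 1)
  omega

theorem parent_lt (hb : IsFirstChild P b) {j : ℕ} (h : 0 < j) : P ⟨j, h⟩ < j :=
  (hb.lt _).trans_le ((hb.parent_eq_iff h).1 rfl).1

theorem isTreeFunction (hb : IsFirstChild P b) : IsTreeFunction P := by
  refine ⟨?_, fun i => ⟨⟨b i, hb.pos i⟩, ?_⟩⟩
  · rintro ⟨j, hj⟩ ⟨k, hk⟩ hjk
    exact (hb.le_iff k hk _).2 (((hb.le_iff j hj _).1 le_rfl).trans hjk)
  · exact (hb.parent_eq_iff _).2 ⟨le_rfl, hb.strictMono (Nat.lt_succ_self i)⟩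

theorem children_eq (hb : IsFirstChild P b) (i : ℕ) : children P i = Set.Ico (b i) (b (i + 1)) := by
  ext j
  simp only [children, Set.mem_ofPred_eq, Set.mem_Ico]
  constructor
  · rintro ⟨h, hj⟩
    exact (hb.parent_eq_iff h).1 hj
  · intro h
    have h0 : 0 < j := (hb.pos i).trans_le h.1
    exact ⟨h0, (hb.parent_eq_iff h0).2 h⟩

theorem add_arity (hb : IsFirstChild P b) (i : ℕ) : b i + arity P i = b (i + 1) := by
  have := hb.strictMono (Nat.lt_add_one i)
  rw [arity, hb.children_eq, ← Finset.coe_Ico, Set.ncard_coe_finset, Nat.card_Ico]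
  omega

theorem arity_pos (hb : IsFirstChild P b) (i : ℕ) : 0 < arity P i := by
  have := hb.strictMono (Nat.lt_add_one i)
  have := hb.add_arity i
  omega

theorem child_eq (hb : IsFirstChild P b) {i k : ℕ} (hk : k < arity P i) :
    child P i k = b i + k := by
  classical
  have hp : ∀ m, m ∈ children P i ↔ b i ≤ m ∧ m < b (i + 1) := fun m => by
    rw [hb.children_eq, Set.mem_Ico]
  have hadd := hb.add_arity i
  have hc : Nat.count (fun m => m ∈ children P i) (b i + k) = k := by
    rw [Nat.count_add, Nat.count_iff_forall_not.2, zero_add, Nat.count_iff_forall.2]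
    · intro m hm
      exact (hp _).2 (by omega)
    · intro m hm h
      have := (hp _).1 h
      omega
  have := Nat.nth_count (p := fun m => m ∈ children P i) (n := b i + k) ((hp _).2 (by omega))
  rwa [hc] at this

theorem exists_eq_add (hb : IsFirstChild P b) {j : ℕ} (h : 0 < j) :
    ∃ k < arity P (P ⟨j, h⟩), j = b (P ⟨j, h⟩) + k := by
  have h1 := (hb.parent_eq_iff h).1 rfl
  have h2 := hb.add_arity (P ⟨j, h⟩)
  exact ⟨j - b (P ⟨j, h⟩), by omega, by omega⟩

theorem parent_add (hb : IsFirstChild P b) {i k : ℕ} (hk : k < arity P i) (h : 0 < b i + k) :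
    P ⟨b i + k, h⟩ = i := by
  have := hb.add_arity i
  exact (hb.parent_eq_iff h).2 (by omega)

end IsFirstChild

/-! ### Descendants in increasing order -/

section Descendants

variable {P : ℕ+ → ℕ} {b : ℕ → ℕ}

theorem iter_succ_of_pos (P : ℕ+ → ℕ) (k : ℕ) {m : ℕ} (h : 0 < m) :
    iter P (k + 1) m = iter P k (P ⟨m, h⟩) := by
  induction k with
  | zero => simp [iter, h]
  | succ k ih => rw [iter, ih, iter]

theorem iter_succ_zero (P : ℕ+ → ℕ) (k : ℕ) : iter P (k + 1) 0 = none := by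
  induction k with
  | zero => simp [iter]
  | succ k ih => rw [iter, ih]; rfl

theorem self_mem_descendants (P : ℕ+ → ℕ) (n : ℕ) : n ∈ descendants P n := ⟨0, rfl⟩

theorem mem_descendants_iff {n m : ℕ} :
    m ∈ descendants P n ↔ m = n ∨ ∃ h : 0 < m, P ⟨m, h⟩ ∈ descendants P n := by
  constructor
  · rintro ⟨_ | k, hk⟩
    · exact Or.inl (Option.some_injective _ hk)
    · rcases Nat.eq_zero_or_pos m with rfl | h
      · simp [iter_succ_zero] at hk
      · exact Or.inr ⟨h, k, by rwa [← iter_succ_of_pos]⟩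
  · rintro (rfl | ⟨h, k, hk⟩)
    · exact self_mem_descendants P m
    · exact ⟨k + 1, by rwa [iter_succ_of_pos _ _ h]⟩

/-- The descendants of `n` in increasing order. -/
noncomputable def nthDescendant (P : ℕ+ → ℕ) (n i : ℕ) : ℕ :=
  Nat.nth (fun m => m ∈ descendants P n) i

theorem exists_nthDescendant_eq {n m : ℕ} (h : m ∈ descendants P n) :
    ∃ i, nthDescendant P n i = m :=
  Nat.subset_range_nth (p := fun m => m ∈ descendants P n) h

namespace IsFirstChild

theorem le_of_mem_descendants (hb : IsFirstChild P b) {n m : ℕ} (hm : m ∈ descendants P n) :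
    n ≤ m := by
  induction m using Nat.strong_induction_on with
  | _ m ih =>
    rcases mem_descendants_iff.1 hm with rfl | ⟨h, hp⟩
    · exact le_rfl
    · exact (ih _ (hb.parent_lt h) hp).trans (hb.parent_lt h).le

theorem add_mem_descendants_iff (hb : IsFirstChild P b) {n y k : ℕ} (hy : n ≤ y)
    (hk : k < arity P y) : b y + k ∈ descendants P n ↔ y ∈ descendants P n := by
  have h0 : 0 < b y + k := by have := hb.pos y; omega
  have := hb.lt y
  rw [mem_descendants_iff]
  constructor
  · rintro (h | ⟨h, hp⟩)
    · omega
    · rwa [hb.parent_add hk] at hp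
  · intro h
    exact Or.inr ⟨h0, by rwa [hb.parent_add hk]⟩

theorem infinite_descendants (hb : IsFirstChild P b) (n : ℕ) : (descendants P n).Infinite := by
  refine Set.infinite_of_forall_exists_gt fun a => ?_
  induction a with
  | zero =>
    refine ⟨b n, ?_, hb.pos n⟩
    simpa using (hb.add_mem_descendants_iff le_rfl (hb.arity_pos n)).2 (self_mem_descendants P n)
  | succ a ih =>
    obtain ⟨x, hx, hax⟩ := ih
    refine ⟨b x, ?_, ?_⟩
    · simpa using (hb.add_mem_descendants_iff (hb.le_of_mem_descendants hx) (hb.arity_pos x)).2 hx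
    · have := hb.lt x
      omega

theorem nthDescendant_mem (hb : IsFirstChild P b) (n i : ℕ) :
    nthDescendant P n i ∈ descendants P n :=
  Nat.nth_mem_of_infinite (hb.infinite_descendants n) i

theorem nthDescendant_strictMono (hb : IsFirstChild P b) (n : ℕ) :
    StrictMono (nthDescendant P n) :=
  Nat.nth_strictMono (hb.infinite_descendants n)

theorem nthDescendant_zero (hb : IsFirstChild P b) (n : ℕ) : nthDescendant P n 0 = n := by
  obtain ⟨i, hi⟩ := exists_nthDescendant_eq (self_mem_descendants P n)
  have h1 := (hb.nthDescendant_strictMono n).monotone (Nat.zero_le i)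
  have h2 := hb.le_of_mem_descendants (hb.nthDescendant_mem n 0)
  omega

-- Below `b y`, the descendants of `n` are `n` itself (the summand 1) and the children of its
-- descendants smaller than `y`.
open Classical in
theorem count_descendants (hb : IsFirstChild P b) {n y : ℕ} (hy : n ≤ y) :
    Nat.count (fun m => m ∈ descendants P n) (b y) =
      1 + ∑ z ∈ Finset.range y with z ∈ descendants P n, arity P z := by
  induction y, hy using Nat.le_induction with
  | base =>
    have h1 : ∀ m, m < b n → (m ∈ descendants P n ↔ m = n) := by
      intro m hm
      refine ⟨fun h => ?_, fun h => h ▸ self_mem_descendants P n⟩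
      rcases mem_descendants_iff.1 h with rfl | ⟨h0, hp⟩
      · rfl
      · have := (hb.le_iff m h0 n).1 (hb.le_of_mem_descendants hp)
        omega
    have h2 : {x ∈ Finset.range (b n) | x ∈ descendants P n} = {n} := by
      ext m
      simp only [Finset.mem_filter, Finset.mem_range, Finset.mem_singleton]
      constructor
      · rintro ⟨h, h'⟩
        exact (h1 m h).1 h'
      · rintro rfl
        exact ⟨hb.lt m, self_mem_descendants P m⟩
    have h3 : {x ∈ Finset.range n | x ∈ descendants P n} = ∅ := by
      refine Finset.filter_eq_empty_iff.2 fun x hx h => ?_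
      have := hb.le_of_mem_descendants h
      have := Finset.mem_range.1 hx
      omega
    rw [Nat.count_eq_card_filter_range, h2, h3]
    simp
  | succ y hy ih =>
    rw [← hb.add_arity, Nat.count_add, ih, Finset.sum_filter, Finset.sum_filter,
      Finset.sum_range_succ, add_assoc]
    congr 2
    split_ifs with h
    · exact Nat.count_iff_forall.2 fun k hk => (hb.add_mem_descendants_iff hy hk).2 h
    · exact Nat.count_iff_forall_not.2 fun k hk h' => h ((hb.add_mem_descendants_iff hy hk).1 h')

open Classical in
/-- The children of the descendants of `n` are numbered consecutively. -/
theorem child_nthDescendant (hb : IsFirstChild P b) (n i : ℕ) {k : ℕ}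
    (hk : k < arity P (nthDescendant P n i)) :
    child P (nthDescendant P n i) k =
      nthDescendant P n (1 + ∑ l ∈ Finset.range i, arity P (nthDescendant P n l) + k) := by
  have hmem := hb.nthDescendant_mem n i
  have hle := hb.le_of_mem_descendants hmem
  -- The descendants below the `i`-th one are exactly the first `i` in the enumeration.
  have hsum : ∀ i, ∑ z ∈ Finset.range (nthDescendant P n i) with z ∈ descendants P n, arity P z =
      ∑ l ∈ Finset.range i, arity P (nthDescendant P n l) := by
    intro i
    induction i with
    | zero =>
      rw [hb.nthDescendant_zero, Finset.sum_filter]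
      refine Finset.sum_eq_zero fun z hz => if_neg fun h => ?_
      have := hb.le_of_mem_descendants h
      have := Finset.mem_range.1 hz
      omega
    | succ i ih =>
      have := Nat.filter_range_nth_eq_insert_of_infinite (p := fun m => m ∈ descendants P n)
        (hb.infinite_descendants n) i
      unfold nthDescendant at ih ⊢
      rw [this, Finset.sum_insert (by simp), Finset.sum_range_succ, ih, add_comm]
  have hcount : Nat.count (fun m => m ∈ descendants P n) (b (nthDescendant P n i) + k) =
      1 + ∑ l ∈ Finset.range i, arity P (nthDescendant P n l) + k := by
    rw [Nat.count_add, hb.count_descendants hle, hsum]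
    congr 1
    exact Nat.count_iff_forall.2 fun l hl => (hb.add_mem_descendants_iff hle (hl.trans hk)).2 hmem
  rw [hb.child_eq hk, ← hcount]
  exact (Nat.nth_count (p := fun m => m ∈ descendants P n)
    ((hb.add_mem_descendants_iff hle hk).2 hmem)).symm

theorem exists_nthDescendant_eq_child (hb : IsFirstChild P b) (n : ℕ) {j : ℕ} (hj : 0 < j) :
    ∃ i < j, ∃ k < arity P (nthDescendant P n i),
      j = 1 + ∑ l ∈ Finset.range i, arity P (nthDescendant P n l) + k := by
  have hlt := hb.nthDescendant_strictMono n hj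
  rw [hb.nthDescendant_zero] at hlt
  rcases mem_descendants_iff.1 (hb.nthDescendant_mem n j) with h | ⟨h0, hp⟩
  · omega
  obtain ⟨i, hi⟩ := exists_nthDescendant_eq hp
  obtain ⟨k, hk, hk'⟩ := hb.exists_eq_add h0
  rw [← hi] at hk hk'
  refine ⟨i, ?_, k, hk, (hb.nthDescendant_strictMono n).injective ?_⟩
  · rw [← (hb.nthDescendant_strictMono n).lt_iff_lt, hi]
    exact hb.parent_lt h0
  · rw [← hb.child_nthDescendant n i hk, hb.child_eq hk, ← hk']

end IsFirstChild

/-! ### Bisimulations between nodes -/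

/-- Related nodes have the same number of children, and these are pairwise related. -/
def IsBisimulation (P : ℕ+ → ℕ) (R : ℕ → ℕ → Prop) : Prop :=
  ∀ x y, R x y → arity P x = arity P y ∧ ∀ k < arity P x, R (child P x k) (child P y k)

/-- The `j`-th descendant is the `k`-th child of the `i`-th for some `i < j`, where `i` and `k` are
read off from the arities of earlier descendants; these agree on both sides by induction. -/
theorem IsFirstChild.rel_nthDescendant (hb : IsFirstChild P b) {R : ℕ → ℕ → Prop}
    (hR : IsBisimulation P R) {n m : ℕ} (h : R n m) (j : ℕ) :
    R (nthDescendant P n j) (nthDescendant P m j) := by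
  induction j using Nat.strong_induction_on with
  | _ j ih =>
    rcases Nat.eq_zero_or_pos j with rfl | hj
    · rwa [hb.nthDescendant_zero, hb.nthDescendant_zero]
    obtain ⟨i, hi, k, hk, hij⟩ := hb.exists_nthDescendant_eq_child n hj
    have hsum : ∑ l ∈ Finset.range i, arity P (nthDescendant P n l) =
        ∑ l ∈ Finset.range i, arity P (nthDescendant P m l) :=
      Finset.sum_congr rfl fun l hl => (hR _ _ (ih l ((Finset.mem_range.1 hl).trans hi))).1
    obtain ⟨h1, h2⟩ := hR _ _ (ih i hi)
    have := h2 k hk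
    rwa [hb.child_nthDescendant n i hk, hb.child_nthDescendant m i (h1 ▸ hk), ← hsum, ← hij] at this

theorem IsBisimulation.subtree_eq {R : ℕ → ℕ → Prop} (hR : IsBisimulation P R) {n m : ℕ}
    (h : R n m) : subtree P n = subtree P m := by
  funext w
  induction w generalizing n m with
  | nil => simp [subtree, nodeAt, (hR _ _ h).1]
  | cons i w ih =>
    obtain ⟨h1, h2⟩ := hR _ _ h
    simp only [subtree, nodeAt, ← h1]
    split_ifs with hi
    · exact ih (h2 i hi)
    · rfl

theorem subtree_cons {n i : ℕ} (hi : i < arity P n) (w : List ℕ) :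
    subtree P n (i :: w) = subtree P (child P n i) w := by
  simp [subtree, nodeAt, hi]

theorem isBisimulation_subtree (P : ℕ+ → ℕ) :
    IsBisimulation P fun x y => subtree P x = subtree P y := by
  intro x y h
  have h1 : arity P x = arity P y := by simpa [subtree, nodeAt] using congrFun h []
  refine ⟨h1, fun k hk => funext fun w => ?_⟩
  rw [← subtree_cons hk, ← subtree_cons (h1 ▸ hk), h]

/-- Equal subtrees have equal arities at each index, so corresponding children receive the same
index. -/
theorem IsFirstChild.isBisimulation_nthDescendant (hb : IsFirstChild P b) {n m : ℕ}
    (h : subtree P n = subtree P m) :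
    IsBisimulation P fun x y => ∃ i, x = nthDescendant P n i ∧ y = nthDescendant P m i := by
  have har : ∀ i, arity P (nthDescendant P n i) = arity P (nthDescendant P m i) := fun i =>
    (isBisimulation_subtree P _ _ (hb.rel_nthDescendant (isBisimulation_subtree P) h i)).1
  rintro _ _ ⟨i, rfl, rfl⟩
  refine ⟨har i, fun k hk => ⟨_, hb.child_nthDescendant n i hk, ?_⟩⟩
  rw [hb.child_nthDescendant m i (har i ▸ hk)]
  simp only [har]

/-- The indices, among the descendants of `x`, of those lying below its `k`-th child depend only on
the shape of the subtree. The child's subsequence is thus the same selection from the parent's on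
both sides. -/
theorem IsFirstChild.isBisimulation_subtree_subseq {A : Type*} (hb : IsFirstChild P b)
    (σ : ℕ → A) :
    IsBisimulation P fun x y => subtree P x = subtree P y ∧
      subseq σ (descendants P x) = subseq σ (descendants P y) := by
  rintro n m ⟨ht, hs⟩
  obtain ⟨h1, h2⟩ := isBisimulation_subtree P _ _ ht
  refine ⟨h1, fun k hk => ⟨h2 k hk, funext fun j => ?_⟩⟩
  have hB := hb.isBisimulation_nthDescendant ht
  have h0 := (hB n m ⟨0, (hb.nthDescendant_zero n).symm, (hb.nthDescendant_zero m).symm⟩).2 k hk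
  obtain ⟨i, hn, hm⟩ := hb.rel_nthDescendant hB h0 j
  have := congrFun hs i
  unfold nthDescendant at hn hm
  simp only [subseq] at this ⊢
  rw [hn, hm, this]

end Descendants

/-! ### Fixed points of morphisms and breadth-first numbering -/

section Words

theorem applyWord_append {Γ : Type*} (f : Γ → List Γ) (v w : List Γ) :
    applyWord f (v ++ w) = applyWord f v ++ applyWord f w := List.flatMap_append

theorem applyWord_singleton {Γ : Type*} (f : Γ → List Γ) (c : Γ) : applyWord f [c] = f c := by
  simp [applyWord]

theorem applyWord_map_range_succ {Γ : Type*} (f : Γ → List Γ) (ρ : ℕ → Γ) (L : ℕ) :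
    applyWord f ((List.range (L + 1)).map ρ) =
      applyWord f ((List.range L).map ρ) ++ f (ρ L) := by
  rw [List.range_succ, List.map_append, applyWord_append, List.map_singleton,
    applyWord_singleton]

theorem map_range_add {Γ : Type*} (ρ : ℕ → Γ) (m n : ℕ) :
    (List.range (m + n)).map ρ =
      (List.range m).map ρ ++ (List.range n).map fun k => ρ (m + k) := by
  rw [List.range_add, List.map_append, List.map_map]
  rfl

/-- If `f (ρ i)` spells the colours of the children of `i`, preceded by `ρ 0` when `i = 0`, then
`ρ` is the limit of the iterates of `f` at `ρ 0`. -/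
theorem IsFirstChild.isLimitOfWords {P : ℕ+ → ℕ} {b : ℕ → ℕ} (hb : IsFirstChild P b)
    {Γ : Type*} {f : Γ → List Γ} {ρ : ℕ → Γ}
    (h0 : f (ρ 0) = ρ 0 :: (List.range (arity P 0)).map fun k => ρ (b 0 + k))
    (hs : ∀ i, 0 < i → f (ρ i) = (List.range (arity P i)).map fun k => ρ (b i + k)) :
    IsLimitOfWords (fun n => (applyWord f)^[n] [ρ 0]) ρ := by
  -- False for the empty prefix, as `b 0 = 1`: position 0 is nobody's child and comes from the extra
  -- first letter of `f (ρ 0)`.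
  have happ : ∀ L, applyWord f ((List.range (L + 1)).map ρ) = (List.range (b (L + 1))).map ρ := by
    intro L
    induction L with
    | zero =>
      rw [applyWord_map_range_succ, ← hb.add_arity, map_range_add, h0, hb.zero]
      simp [applyWord]
    | succ L ih =>
      rw [applyWord_map_range_succ, ih, hs _ L.succ_pos, ← hb.add_arity (L + 1), map_range_add]
  have hit : ∀ n, ∃ L, n ≤ L ∧ (applyWord f)^[n] [ρ 0] = (List.range (L + 1)).map ρ := by
    intro n
    induction n with
    | zero => exact ⟨0, le_rfl, by simp⟩
    | succ n ih =>
      obtain ⟨L, hL, h⟩ := ih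
      have := hb.lt (L + 1)
      refine ⟨b (L + 1) - 1, by omega, ?_⟩
      rw [Function.iterate_succ_apply', h, happ, Nat.sub_add_cancel (hb.pos _)]
  intro i
  filter_upwards [eventually_ge_atTop i] with n hn
  obtain ⟨L, hL, h⟩ := hit n
  rw [h, List.getElem?_map, List.getElem?_range (by omega)]
  rfl

/-- A limit of the iterates of `f` is fixed by `f`: it maps prefixes to prefixes. -/
theorem exists_applyWord_map_range {Γ : Type*} {f : Γ → List Γ} {a : Γ} {u : List Γ}
    (ha : f a = a :: u) {ρ : ℕ → Γ} (hρ : IsLimitOfWords (fun n => (applyWord f)^[n] [a]) ρ)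
    (L : ℕ) : ∃ N, applyWord f ((List.range L).map ρ) = (List.range N).map ρ := by
  have hstep : ∀ n, (applyWord f)^[n] [a] <+: (applyWord f)^[n + 1] [a] := by
    intro n
    induction n with
    | zero => exact ⟨u, by simp [applyWord, ha]⟩
    | succ n ih =>
      obtain ⟨v, hv⟩ := ih
      refine ⟨applyWord f v, ?_⟩
      rw [Function.iterate_succ_apply', Function.iterate_succ_apply' _ (n + 1), ← hv,
        applyWord_append]
  have hmono : ∀ n m, n ≤ m → (applyWord f)^[n] [a] <+: (applyWord f)^[m] [a] := by
    intro n m hnm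
    induction m, hnm using Nat.le_induction with
    | base => exact List.prefix_rfl
    | succ m _ ih => exact ih.trans (hstep m)
  -- Each iterate is a prefix of `ρ`: its letters persist in later iterates, where they agree with
  -- `ρ`.
  have hpre : ∀ n, (applyWord f)^[n] [a] =
      (List.range ((applyWord f)^[n] [a]).length).map ρ := by
    intro n
    refine List.ext_getElem (by simp) fun i h1 h2 => ?_
    obtain ⟨m, hm, hnm⟩ := ((hρ i).and (eventually_ge_atTop n)).exists
    have h3 := (hmono n m hnm).getElem h1
    obtain ⟨h4, h5⟩ := List.getElem?_eq_some_iff.1 hm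
    rw [h3, List.getElem_map, List.getElem_range]
    exact h5
  obtain ⟨n, hn⟩ := (hρ L).exists
  obtain ⟨hlen, -⟩ := List.getElem?_eq_some_iff.1 hn
  have hL : (List.range L).map ρ <+: (applyWord f)^[n] [a] := by
    rw [hpre n]
    obtain ⟨k, hk⟩ := Nat.exists_eq_add_of_le hlen.le
    exact ⟨_, by rw [hk, map_range_add]⟩
  obtain ⟨v, hv⟩ := hL
  have h1 : applyWord f ((List.range L).map ρ) <+: (applyWord f)^[n + 1] [a] :=
    ⟨applyWord f v, by rw [Function.iterate_succ_apply', ← applyWord_append, hv]⟩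
  refine ⟨(applyWord f ((List.range L).map ρ)).length, ?_⟩
  have h2 := hpre (n + 1)
  rw [List.prefix_iff_eq_take.1 h1]
  conv_lhs => rw [h2]
  rw [← List.map_take, List.take_range]
  congr 2
  have := h1.length_le
  simp only [List.length_take]

/-- The parent of `j` is the last `i` with `b i ≤ j`. It exists because `b 0 = 1 ≤ j`, and searching
up to `j` suffices because `i ≤ b i`. -/
theorem exists_isFirstChild_of_strictMono {b : ℕ → ℕ} (h0 : b 0 = 1) (hb : StrictMono b) :
    ∃ P, IsFirstChild P b := by
  refine ⟨fun j => Nat.findGreatest (fun i => b i ≤ j) j, h0, hb, fun j hj i => ?_⟩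
  simp only [PNat.mk_coe]
  constructor
  · intro hi
    have := Nat.findGreatest_spec (P := fun i => b i ≤ j) (Nat.zero_le j) (by omega)
    exact (hb.monotone hi).trans this
  · intro hi
    exact Nat.le_findGreatest ((hb.le_apply).trans hi) hi

end Words

/-! ### The two implications -/

theorem finite_range_of_factor {ι β γ : Type*} [Finite γ] (c : ι → γ) (g : ι → β)
    (h : ∀ x y, c x = c y → g x = g y) : (Set.range g).Finite := by
  refine (Set.finite_range fun q : Set.range c => g q.2.choose).subset ?_
  rintro _ ⟨x, rfl⟩
  have hx : c x ∈ Set.range c := ⟨x, rfl⟩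
  exact ⟨⟨c x, hx⟩, h _ _ hx.choose_spec⟩

theorem IsMorphic.exists_tree {A : Type*} {σ : ℕ → A} (hσ : IsMorphic σ) :
    ∃ P : ℕ+ → ℕ, IsRationalTreeFunction P ∧
      (Set.range (fun n : ℕ => subseq σ (descendants P n))).Finite := by
  obtain ⟨Γ, _, τ, ρ, ⟨f, a, u, hne, hu, ha, hρ⟩, hτ⟩ := hσ
  have hρ0 : ρ 0 = a := by
    obtain ⟨n, hn⟩ := (hρ 0).exists
    have hh : ∀ n, ∃ v, (applyWord f)^[n] [a] = a :: v := by
      intro n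
      induction n with
      | zero => exact ⟨[], rfl⟩
      | succ n ih =>
        obtain ⟨v, hv⟩ := ih
        exact ⟨u ++ applyWord f v, by simp [Function.iterate_succ_apply', hv, applyWord, ha]⟩
    obtain ⟨v, hv⟩ := hh n
    simpa [hv] using hn.symm
  -- Arity of `i`: the first letter of `f a = a u` at the root is position 0 itself, so only `u`
  -- yields children there.
  let e : ℕ → ℕ := fun i => if i = 0 then u.length else (f (ρ i)).length
  let b : ℕ → ℕ := fun i => 1 + ∑ l ∈ Finset.range i, e l
  have hbs : ∀ i, b (i + 1) = b i + e i := fun i => by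
    simp only [b, Finset.sum_range_succ, add_assoc]
  have he : ∀ i, 0 < e i := by
    intro i
    simp only [e]
    split_ifs
    · exact List.length_pos_iff.2 hu
    · exact List.length_pos_iff.2 (hne _)
  obtain ⟨P, hb⟩ : ∃ P, IsFirstChild P b :=
    exists_isFirstChild_of_strictMono (by simp [b])
      (strictMono_nat_of_lt_succ fun i => by have := hbs i; have := he i; omega)
  have har : ∀ i, arity P i = e i := fun i => by
    have := hbs i
    have := hb.add_arity i
    omega
  have happ : ∀ L, applyWord f ((List.range (L + 1)).map ρ) = (List.range (b (L + 1))).map ρ := by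
    intro L
    obtain ⟨N, hN⟩ := exists_applyWord_map_range ha hρ (L + 1)
    have hlen : ∀ L, (applyWord f ((List.range (L + 1)).map ρ)).length = b (L + 1) := by
      intro L
      induction L with
      | zero => simp [applyWord, hρ0, ha, b, e, add_comm]
      | succ L ih => rw [applyWord_map_range_succ, List.length_append, ih, hbs (L + 1)]; simp [e]
    have := hlen L
    rw [hN, List.length_map, List.length_range] at this
    rw [hN, this]
  have hf : ∀ i, 0 < i → f (ρ i) = (List.range (arity P i)).map fun k => ρ (b i + k) := by
    intro i hi
    obtain ⟨i, rfl⟩ := Nat.exists_eq_add_of_le' hi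
    have h := happ (i + 1)
    rw [applyWord_map_range_succ, happ, ← hb.add_arity (i + 1), map_range_add ρ (b (i + 1))] at h
    exact List.append_cancel_left h
  -- The root is related only to itself: a later occurrence of `a` has one child more.
  let R : ℕ → ℕ → Prop := fun x y => x = y ∨ 0 < x ∧ 0 < y ∧ ρ x = ρ y
  have hR : IsBisimulation P R := by
    rintro x y (rfl | ⟨hx, hy, hxy⟩)
    · exact ⟨rfl, fun k _ => Or.inl rfl⟩
    have hh := hf x hx
    rw [hxy, hf y hy] at hh
    have h1 : arity P y = arity P x := by simpa using congrArg List.length hh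
    refine ⟨h1.symm, fun k hk => Or.inr ?_⟩
    rw [hb.child_eq hk, hb.child_eq (h1 ▸ hk)]
    have hbx := hb.pos x
    have hby := hb.pos y
    refine ⟨by omega, by omega, ?_⟩
    have := congrArg (fun l => l[k]?) hh
    simpa [hk, h1] using this.symm
  let c : ℕ → Option Γ := fun x => if x = 0 then none else some (ρ x)
  have hc : ∀ x y, c x = c y → R x y := by
    intro x y h
    simp only [c] at h
    split_ifs at h with hx hy hy
    · exact Or.inl (hx.trans hy.symm)
    · exact Or.inr ⟨Nat.pos_of_ne_zero hx, Nat.pos_of_ne_zero hy, Option.some_injective _ h⟩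
  refine ⟨P, ⟨hb.isTreeFunction, finite_range_of_factor c _ fun x y h => hR.subtree_eq (hc x y h)⟩,
    finite_range_of_factor c _ fun x y h => funext fun i => ?_⟩
  have : ρ (nthDescendant P x i) = ρ (nthDescendant P y i) := by
    rcases hb.rel_nthDescendant hR (hc x y h) i with h | ⟨-, -, h⟩
    · rw [h]
    · exact h
  exact (hτ _).trans ((congrArg τ this).trans (hτ _).symm)

theorem isMorphic_of_tree {A : Type*} {σ : ℕ → A} {P : ℕ+ → ℕ} (hP : IsRationalTreeFunction P)
    (hfin : (Set.range (fun n : ℕ => subseq σ (descendants P n))).Finite) : IsMorphic σ := by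
  obtain ⟨b, hb⟩ := hP.1.exists_isFirstChild
  have hB := hb.isBisimulation_subtree_subseq σ
  let col : ℕ → (List ℕ → Option ℕ) × (ℕ → A) :=
    fun n => (subtree P n, subseq σ (descendants P n))
  let s : Setoid ℕ := Setoid.ker col
  have hcol : ∀ x y, s x y → subtree P x = subtree P y ∧
      subseq σ (descendants P x) = subseq σ (descendants P y) := fun x y h => Prod.ext_iff.1 h
  have hfinite : Finite (Quotient s) := by
    have : Finite (Set.range col) :=
      ((hP.2.prod hfin).subset (by rintro _ ⟨n, rfl⟩; exact ⟨⟨n, rfl⟩, ⟨n, rfl⟩⟩)).to_subtype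
    exact Finite.of_equiv _ (Setoid.quotientKerEquivRange col).symm
  have hout : ∀ n, s (Quotient.mk s n).out n := fun n => Quotient.mk_out n
  -- The root gets a fresh letter `none`, because its image must begin with itself, while other
  -- nodes may share its colour.
  let ρ : ℕ → Option (Quotient s) := fun i => if i = 0 then none else some (Quotient.mk s i)
  let word : ℕ → List (Option (Quotient s)) :=
    fun n => (List.range (arity P n)).map fun k => ρ (b n + k)
  have hρ : ∀ i, 0 < i → ρ i = some (Quotient.mk s i) := fun i hi => if_neg hi.ne'
  have hword : ∀ x y, s x y → word x = word y := by
    intro x y h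
    obtain ⟨h1, h2⟩ := hB x y (hcol x y h)
    simp only [word, ← h1]
    refine List.map_congr_left fun k hk => ?_
    rw [List.mem_range] at hk
    have hbx := hb.pos x
    have hby := hb.pos y
    rw [hρ _ (by omega), hρ _ (by omega)]
    refine congrArg some (Quotient.sound ?_)
    have := h2 k hk
    rw [hb.child_eq hk, hb.child_eq (h1 ▸ hk)] at this
    exact Prod.ext this.1 this.2
  have hne : ∀ n, word n ≠ [] := fun n => by
    have := hb.arity_pos n
    simp only [word, ne_eq, List.map_eq_nil_iff, List.range_eq_nil]
    omega
  let f : Option (Quotient s) → List (Option (Quotient s)) :=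
    fun c => c.elim (none :: word 0) fun q => word q.out
  have hρ0 : ρ 0 = none := if_pos rfl
  refine ⟨Option (Quotient s), inferInstance, fun c => c.elim (σ 0) fun q => σ q.out, ρ,
    ⟨f, none, word 0, ?_, hne 0, rfl, ?_⟩, fun i => ?_⟩
  · rintro (_ | q)
    · exact List.cons_ne_nil _ _
    · exact hne _
  · have := hb.isLimitOfWords (f := f) (ρ := ρ) (by rw [hρ0]; rfl)
      (fun i hi => by rw [hρ i hi]; exact hword _ _ (hout i))
    rwa [hρ0] at this
  · rcases Nat.eq_zero_or_pos i with rfl | hi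
    · rw [hρ0]; rfl
    · rw [hρ i hi]
      -- Term 0 of the subsequence at a node is the value of `σ` there, so the coding does not
      -- depend on the representative.
      have h := congrFun (hcol _ _ (hout i)).2 0
      change σ (nthDescendant P _ 0) = σ (nthDescendant P _ 0) at h
      rw [hb.nthDescendant_zero, hb.nthDescendant_zero] at h
      exact h.symm

end MorphicSeq

theorem mainTheorem2 {A : Type*} (σ : ℕ → A) :
    MorphicSeq.IsMorphic σ ↔
      ∃ P : ℕ+ → ℕ, MorphicSeq.IsRationalTreeFunction P ∧
        (Set.range (fun n : ℕ => MorphicSeq.subseq σ (MorphicSeq.descendants P n))).Finite :=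
  ⟨fun h => h.exists_tree, fun ⟨_, hP, hfin⟩ => MorphicSeq.isMorphic_of_tree hP hfin⟩
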